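/- Let $A\in\mathbb R^{m\times n_1n_2}$ be a random matrix and let $\mathcal A:\mathbb R^{n_1\times n_2}\to\mathbb R^m$, $\mathcal A(X)=A\,X_{vec}$, where $X_{vec}$ stacks the columns of $X$. A matrix is called $k$-joint-sparse if at most $k$ of its rows are nonzero. For positive integers $r,k$, the RIP constant $\delta_{r,k}=\delta_{r,k}(\mathcal A)$ is the smallest $\delta\ge 0$ such that $$(1-\delta)\|X\|_F^2\le\|\mathcal A(X)\|_{\ell_2}^2\le(1+\delta)\|X\|_F^2$$ for all $k$-joint-sparse matrices $X\in\mathbb R^{n_1\times n_2}$ of rank at most $r$. Fix one of the following three types of entry distributions: (i) Gaussian $\mathcal N(0,1/m)$; (ii) Bernoulli, i.e. $\pm1/\sqrt m$ with probability $1/2$ each; (iii) subgaussian with a fixed parameter $s\ge 0$, normalised: each entry $a$ of $A$ has variance $1/m$ and satisfies $\mathbb E\,e^{ta}\le e^{(s/m)t^2/2}$ for all $t\in\mathbb R$ (in particular, mean $0$). Let $0<\delta<1$. Then there are constants $C,\kappa_0,\kappa_1>0$, depending only on $\delta$ and on the type of distribution (including $s$ in case (iii)), such that for all integers $m,n_1,n_2\ge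 0$, $1\le k\le n_1$ and $r\ge 1$ with $$m\ \ge\ \kappa_1\bigl(k\log(n_1/k)+(k+1)r+n_2r\bigr),$$ if the entries of $A$ are independent with laws of the chosen type, then $$\Pr\bigl(\delta_{r,k}(\mathcal A)\le\delta\bigr)\ >\ 1-C e^{-\kappa_0 m}.$$ -/

import Mathlib

open MeasureTheory ProbabilityTheory
open scoped NNReal ENNReal

/-- The linear map `X ↦ A X_vec` from `ℝ^{n₁ × n₂}` to `ℝ^m` with matrix `A`, where `X_vec` stacks the
columns of `X`: the entry of `X_vec` with index `(j, i)` is `X i j`. -/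
noncomputable def samplingMap {m n₁ n₂ : ℕ} (A : Matrix (Fin m) (Fin n₂ × Fin n₁) ℝ) :
    Matrix (Fin n₁) (Fin n₂) ℝ →ₗ[ℝ] EuclideanSpace ℝ (Fin m) where
  toFun X := WithLp.toLp 2 (A.mulVec X.vec)
  map_add' X Y := by rw [Matrix.vec_add, Matrix.mulVec_add, WithLp.toLp_add]
  map_smul' a X := by
    rw [Matrix.vec_smul, Matrix.mulVec_smul, WithLp.toLp_smul, RingHom.id_apply]

/-- `X` is `k`-joint-sparse: at most `k` rows of `X` contain nonzero elements. -/
def IsJointSparse {n₁ n₂ : ℕ} (k : ℕ) (X : Matrix (Fin n₁) (Fin n₂) ℝ) : Prop :=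
  {i : Fin n₁ | ∃ j : Fin n₂, X i j ≠ 0}.ncard ≤ k

/-- The Frobenius norm of a matrix. -/
noncomputable def frobeniusNorm {n₁ n₂ : ℕ} (X : Matrix (Fin n₁) (Fin n₂) ℝ) : ℝ :=
  Real.sqrt (∑ i, ∑ j, X i j ^ 2)

/-- The joint-sparse and low-rank restricted isometry property with constant `δ`: the inequalities
`(1 - δ) ‖X‖_F² ≤ ‖𝒜 X‖² ≤ (1 + δ) ‖X‖_F²` for all `k`-joint-sparse `X` of rank at most `r`. -/
def HasRIP {m n₁ n₂ : ℕ}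
    (𝒜 : Matrix (Fin n₁) (Fin n₂) ℝ →ₗ[ℝ] EuclideanSpace ℝ (Fin m)) (r k : ℕ) (δ : ℝ) : Prop :=
  ∀ X : Matrix (Fin n₁) (Fin n₂) ℝ, X.rank ≤ r → IsJointSparse k X →
    (1 - δ) * frobeniusNorm X ^ 2 ≤ ‖𝒜 X‖ ^ 2 ∧ ‖𝒜 X‖ ^ 2 ≤ (1 + δ) * frobeniusNorm X ^ 2

/-- The RIP constant `δ_{r,k}`: the smallest `δ ≥ 0` with which the property holds. -/
noncomputable def ripConstant {m n₁ n₂ : ℕ}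
    (𝒜 : Matrix (Fin n₁) (Fin n₂) ℝ →ₗ[ℝ] EuclideanSpace ℝ (Fin m)) (r k : ℕ) : ℝ :=
  sInf {δ : ℝ | 0 ≤ δ ∧ HasRIP 𝒜 r k δ}

/-- The infimum that defines the RIP constant is attained. -/
theorem isLeast_ripConstant {m n₁ n₂ : ℕ}
    (𝒜 : Matrix (Fin n₁) (Fin n₂) ℝ →ₗ[ℝ] EuclideanSpace ℝ (Fin m)) (r k : ℕ) :
    IsLeast {δ : ℝ | 0 ≤ δ ∧ HasRIP 𝒜 r k δ} (ripConstant 𝒜 r k) := by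
  have hbdd : BddBelow {δ : ℝ | 0 ≤ δ ∧ HasRIP 𝒜 r k δ} := ⟨0, fun δ h => h.1⟩
  have hne : {δ : ℝ | 0 ≤ δ ∧ HasRIP 𝒜 r k δ}.Nonempty := by
    have hb : ∃ M : ℝ, 0 ≤ M ∧ ∀ X, ‖𝒜 X‖ ≤ M * frobeniusNorm X := by
      let e : EuclideanSpace ℝ (Fin n₁ × Fin n₂) →ₗ[ℝ] Matrix (Fin n₁) (Fin n₂) ℝ :=
        { toFun := fun x => Matrix.of fun i j => x (i, j)
          map_add' := fun _ _ => rfl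
          map_smul' := fun _ _ => rfl }
      let L := LinearMap.toContinuousLinearMap (𝒜 ∘ₗ e)
      refine ⟨‖L‖, norm_nonneg _, fun X => ?_⟩
      have h := L.le_opNorm (WithLp.toLp 2 fun p : Fin n₁ × Fin n₂ => X p.1 p.2)
      have h2 : ‖(WithLp.toLp 2 fun p : Fin n₁ × Fin n₂ => X p.1 p.2 :
          EuclideanSpace ℝ (Fin n₁ × Fin n₂))‖ = frobeniusNorm X := by
        simp only [EuclideanSpace.norm_eq, Real.norm_eq_abs, sq_abs, frobeniusNorm]
        exact congrArg Real.sqrt (Fintype.sum_prod_type fun p : Fin n₁ × Fin n₂ => X p.1 p.2 ^ 2)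
      rw [h2] at h
      exact h
    obtain ⟨M, hM, hX⟩ := hb
    refine ⟨1 + M ^ 2, by positivity, fun X _ _ => ?_⟩
    have h1 := pow_le_pow_left₀ (norm_nonneg (𝒜 X)) (hX X) 2
    constructor
    · nlinarith [sq_nonneg ‖𝒜 X‖, mul_nonneg (sq_nonneg M) (sq_nonneg (frobeniusNorm X))]
    · nlinarith [sq_nonneg (frobeniusNorm X)]
  have hclosed : IsClosed {δ : ℝ | 0 ≤ δ ∧ HasRIP 𝒜 r k δ} := by
    simp only [HasRIP, Set.ofPred_and, Set.ofPred_forall]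
    refine isClosed_Ici.inter ?_
    refine isClosed_iInter fun X => isClosed_iInter fun _ => isClosed_iInter fun _ => ?_
    exact (isClosed_le (by fun_prop) (by fun_prop)).inter (isClosed_le (by fun_prop) (by fun_prop))
  exact hclosed.isLeast_csInf hne hbdd

theorem ripConstant_le_iff {m n₁ n₂ : ℕ}
    (𝒜 : Matrix (Fin n₁) (Fin n₂) ℝ →ₗ[ℝ] EuclideanSpace ℝ (Fin m)) (r k : ℕ) {δ : ℝ}
    (hδ : 0 ≤ δ) : ripConstant 𝒜 r k ≤ δ ↔ HasRIP 𝒜 r k δ := by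
  constructor
  · intro h X hr hk
    have h2 := (isLeast_ripConstant 𝒜 r k).1.2 X hr hk
    constructor
    · nlinarith [h2.1, sq_nonneg (frobeniusNorm X)]
    · nlinarith [h2.2, sq_nonneg (frobeniusNorm X)]
  · intro h
    exact (isLeast_ripConstant 𝒜 r k).2 ⟨hδ, h⟩

/-- The three types of entry distributions; the subgaussian type carries its parameter `s`. -/
inductive EntryEnsemble where
  | gaussian : EntryEnsemble
  | bernoulli : EntryEnsemble
  | subgaussian (s : ℝ≥0) : EntryEnsemble

/-- `ν` is an admissible law for an entry of a sampling matrix with `m` rows: the Gaussian law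
`N(0, 1/m)`, the law giving mass `1/2` to each of `± 1/√m`, or a probability law with variance `1/m`
which is subgaussian with parameter `s / m`, that is, `∫ exp (t x) dν(x) ≤ exp ((s / m) t² / 2)` for
all real `t` (so its mean is `0`). -/
def EntryEnsemble.IsEntryLaw : EntryEnsemble → ℕ → Measure ℝ → Prop
  | .gaussian, m, ν => ν = gaussianReal 0 (1 / (m : ℝ≥0))
  | .bernoulli, m, ν =>
      ν = (1 / 2 : ℝ≥0∞) • Measure.dirac (1 / Real.sqrt m) +
        (1 / 2 : ℝ≥0∞) • Measure.dirac (-(1 / Real.sqrt m))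
  | .subgaussian s, m, ν =>
      IsProbabilityMeasure ν ∧ variance id ν = 1 / (m : ℝ) ∧
        HasSubgaussianMGF id (s / (m : ℝ≥0)) ν

/-! All three ensembles are subgaussian with a fixed parameter, so one argument serves them all. For
a fixed `X`, the suitably rescaled coordinates of `𝒜 X` are independent subgaussian variables with
second moment 1. Their centred squares have moment generating function at most `exp (K x²)` near 0,
and Chernoff's bound makes `‖𝒜 X‖²` close to `‖X‖_F²` outside an event of probability `2 exp (-c m)`
(`exists_measure_samplingMap_le`).

Uniformity comes from a net of factors. A matrix of rank at most `r` with rows in a `k`-set `S` is a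
product of a contraction `U : ℝ^r → ℝ^S` and an `r × n₂` factor `B` (`exists_eq_extendProduct`).
With `N = 48 / δ`, the `δ/16`-nets of the two unit balls have at most `N^(rk)` and `N^(n₂r)` points.
Near-isometry at the products of net points extends to all admissible matrices (`hasRIP_of_net`),
because the error of approximation is a sum of two matrices of the same class. The union bound over
`S`, `U`, `B` costs `exp (O(q))`, where `q` is the bracket in the hypothesis on `m`, and half of the
exponent `c m` pays for it. -/

/-! ### Nets in unit balls. -/

/-- A volume bound for separated subsets of the unit ball. -/
theorem card_le_of_separated_unitBall {E : Type*} [NormedAddCommGroup E] [NormedSpace ℝ E]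
    [FiniteDimensional ℝ E] {ε : ℝ} (hε0 : 0 < ε) (hε1 : ε ≤ 1) (s : Finset E)
    (hs : ∀ c ∈ s, ‖c‖ ≤ 1) (h : ∀ c ∈ s, ∀ d ∈ s, c ≠ d → ε ≤ ‖c - d‖) :
    (s.card : ℝ) ≤ (3 / ε) ^ Module.finrank ℝ E := by
  borelize E
  let μ : Measure E := Measure.addHaar
  -- The balls of radius `ε/2` about the points lie in the ball of radius `1 + ε/2 ≤ 3/2`.
  set ρ : ℝ := 3 / 2 with hρ
  have ρpos : 0 < ρ := by norm_num [hρ]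
  have hε2 : 0 < ε / 2 := by positivity
  have D : Set.Pairwise (s : Set E) (Function.onFun Disjoint fun c => Metric.ball (c : E) (ε / 2)) := by
    rintro c hc d hd hcd
    apply Metric.ball_disjoint_ball
    rw [dist_eq_norm]
    linarith [h c hc d hd hcd]
  have A_subset : (⋃ c ∈ s, Metric.ball (c : E) (ε / 2)) ⊆ Metric.ball (0 : E) ρ := by
    refine Set.iUnion₂_subset fun x hx => Metric.ball_subset_ball' ?_
    rw [dist_zero_right]
    linarith [hs x hx]
  have I : (s.card : ℝ≥0∞) * ENNReal.ofReal ((ε / 2) ^ Module.finrank ℝ E) * μ (Metric.ball 0 1) ≤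
      ENNReal.ofReal (ρ ^ Module.finrank ℝ E) * μ (Metric.ball 0 1) :=
    calc
      _ = μ (⋃ c ∈ s, Metric.ball (c : E) (ε / 2)) := by
        rw [measure_biUnion_finset D fun c _ => measurableSet_ball]
        simp only [μ.addHaar_ball_of_pos _ hε2, Finset.sum_const, nsmul_eq_mul, mul_assoc]
      _ ≤ μ (Metric.ball (0 : E) ρ) := measure_mono A_subset
      _ = _ := by simp only [μ.addHaar_ball_of_pos _ ρpos]
  have J := (ENNReal.mul_le_mul_iff_left (Metric.measure_ball_pos μ (0 : E) zero_lt_one).ne'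
    measure_ball_lt_top.ne).1 I
  have K := ENNReal.toReal_le_of_le_ofReal (pow_nonneg ρpos.le _) J
  rw [ENNReal.toReal_mul, ENNReal.toReal_natCast, ENNReal.toReal_ofReal (by positivity)] at K
  have h3 : (3 / ε) ^ Module.finrank ℝ E = ρ ^ Module.finrank ℝ E / (ε / 2) ^ Module.finrank ℝ E := by
    rw [← div_pow]
    congr 1
    rw [hρ]
    field_simp
  rw [h3, le_div_iff₀ (by positivity)]
  exact K

/-- The unit ball of a finite-dimensional space has an `ε`-net of size at most `(3 / ε) ^ dim`. -/
theorem exists_net_unitBall (E : Type*) [NormedAddCommGroup E] [NormedSpace ℝ E]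
    [FiniteDimensional ℝ E] {ε : ℝ} (hε0 : 0 < ε) (hε1 : ε ≤ 1) :
    ∃ t : Finset E, (∀ x ∈ t, ‖x‖ ≤ 1) ∧ (∀ x : E, ‖x‖ ≤ 1 → ∃ y ∈ t, ‖x - y‖ ≤ ε) ∧
      (t.card : ℝ) ≤ (3 / ε) ^ Module.finrank ℝ E := by
  classical
  let P : ℕ → Prop := fun n => ∃ t : Finset E, (∀ x ∈ t, ‖x‖ ≤ 1) ∧
    (∀ c ∈ t, ∀ d ∈ t, c ≠ d → ε ≤ ‖c - d‖) ∧ t.card = n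
  have hP0 : P 0 := ⟨∅, by simp⟩
  have hPb : ∀ n, P n → n ≤ ⌊(3 / ε) ^ Module.finrank ℝ E⌋₊ := by
    rintro n ⟨t, h1, h2, rfl⟩
    exact Nat.le_floor (card_le_of_separated_unitBall hε0 hε1 t h1 h2)
  -- A separated set of greatest cardinality is a net: a point farther than `ε` from all of it could
  -- be added.
  obtain ⟨t, h1, h2, h3⟩ := Nat.findGreatest_spec (P := P) (hPb 0 hP0) hP0
  refine ⟨t, h1, fun x hx => ?_, card_le_of_separated_unitBall hε0 hε1 t h1 h2⟩
  by_contra! hcon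
  have hxt : x ∉ t := fun hxt => by simpa using (hcon x hxt).trans_le' hε0.le
  have hP : P (t.card + 1) := by
    refine ⟨insert x t, ?_, ?_, Finset.card_insert_of_notMem hxt⟩
    · simpa [hx] using h1
    · intro c hc d hd hcd
      rcases Finset.mem_insert.1 hc with hc' | hc' <;> rcases Finset.mem_insert.1 hd with hd' | hd'
      · exact absurd (hc'.trans hd'.symm) hcd
      · exact hc' ▸ (hcon d hd').le
      · rw [norm_sub_rev]
        exact hd' ▸ (hcon c hc').le
      · exact h2 c hc' d hd' hcd
  have := Nat.le_findGreatest (hPb _ hP) hP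
  omega

/-! ### Reduction to the subgaussian ensemble. -/

/-- Every ensemble is subgaussian, with a parameter that depends only on its type. -/
theorem EntryEnsemble.exists_subgaussian (E : EntryEnsemble) :
    ∃ s : ℝ≥0, ∀ (m : ℕ) (ν : Measure ℝ), 0 < m → E.IsEntryLaw m ν →
      (EntryEnsemble.subgaussian s).IsEntryLaw m ν := by
  match E with
  | .gaussian =>
    refine ⟨1, fun m ν hm h => ?_⟩
    simp only [IsEntryLaw] at h
    subst h
    refine ⟨inferInstance, ?_, ?_, ?_⟩
    · rw [variance_id_gaussianReal]
      simp
    · exact fun t => integrable_exp_mul_gaussianReal t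
    · intro t
      rw [mgf_id_gaussianReal]
      simp
  | .bernoulli =>
    refine ⟨1, fun m ν hm h => ?_⟩
    simp only [IsEntryLaw] at h
    have hprob : IsProbabilityMeasure ν := ⟨by simp [h, ENNReal.inv_two_add_inv_two]⟩
    have hint : ∀ f : ℝ → ℝ, Integrable f ν := by
      intro f
      rw [h]
      refine Integrable.add_measure ?_ ?_ <;>
      exact (integrable_dirac (by simp)).smul_measure (by simp)
    have hval : ∀ f : ℝ → ℝ, ∫ x, f x ∂ν =
        (f (1 / Real.sqrt m) + f (-(1 / Real.sqrt m))) / 2 := by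
      intro f
      have hi := hint f
      rw [h, integrable_add_measure] at hi
      rw [h, integral_add_measure hi.1 hi.2, integral_smul_measure, integral_smul_measure,
        integral_dirac, integral_dirac]
      simp
      ring
    have hsq : (1 / Real.sqrt m) ^ 2 = 1 / (m : ℝ) := by
      rw [div_pow, Real.sq_sqrt (by positivity), one_pow]
    refine ⟨hprob, ?_, fun t => hint _, fun t => ?_⟩
    · rw [variance_eq_integral (by fun_prop), hval, hval]
      simp only [id]
      linear_combination hsq
    · rw [mgf, hval]
      have := Real.cosh_le_exp_half_sq (t * (1 / Real.sqrt m))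
      rw [Real.cosh_eq, mul_pow, hsq] at this
      simp only [id, mul_neg]
      refine this.trans_eq ?_
      congr 1
      push_cast
      ring
  | .subgaussian s => exact ⟨s, fun m ν _ h => h⟩

/-! ### Concentration of sums of squares. -/

/-- A second-order expansion valid on the whole line, needed because the squares it is applied to
are unbounded. -/
theorem exp_le_one_add_add_sq_mul_exp (x : ℝ) :
    Real.exp x ≤ 1 + x + x ^ 2 * Real.exp |x| := by
  rcases le_total 0 x with hx | hx
  · rw [abs_of_nonneg hx]
    have h1 : Real.exp x - 1 ≤ x * Real.exp x := by
      have := Real.add_one_le_exp (-x)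
      have h2 : Real.exp x * Real.exp (-x) = 1 := by rw [← Real.exp_add]; simp
      nlinarith [Real.exp_pos x]
    nlinarith
  · have h0 : 1 ≤ Real.exp |x| := Real.one_le_exp (abs_nonneg x)
    rcases le_or_gt (-1) x with h | h
    · have := (abs_le.1 (Real.abs_exp_sub_one_sub_id_le (abs_le.2 ⟨h, by linarith⟩))).2
      nlinarith [sq_nonneg x]
    · have : Real.exp x ≤ 1 := Real.exp_le_one_iff.2 hx
      nlinarith [sq_nonneg x]

/-- The condition says `a < 1 / (2v)`, so the product with the density still decays like a Gaussian.
-/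
theorem integrable_exp_mul_sq_gaussianReal {a : ℝ} {v : ℝ≥0} (hv : 0 < v) (ha : 2 * a * v < 1) :
    Integrable (fun t => Real.exp (a * t ^ 2)) (gaussianReal 0 v) := by
  rw [gaussianReal_of_var_ne_zero _ hv.ne', integrable_withDensity_iff (measurable_gaussianPDF _ _)
    (Filter.Eventually.of_forall fun _ => ENNReal.ofReal_lt_top)]
  have hv' : (0 : ℝ) < v := hv
  have hb : 0 < (2 * (v : ℝ))⁻¹ - a := by
    have h2 : 0 < 1 / (2 * (v : ℝ)) - a := by
      rw [sub_pos, lt_div_iff₀ (by positivity)]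
      linarith
    simpa using h2
  refine ((integrable_exp_neg_mul_sq hb).mul_const (√(2 * Real.pi * v))⁻¹).congr
    (Filter.Eventually.of_forall fun x => ?_)
  simp only [toReal_gaussianPDF, gaussianPDFReal, sub_zero]
  rw [mul_left_comm, mul_comm, ← Real.exp_add]
  congr 2
  field_simp
  ring

/-- Exponential integrability of the square of a subgaussian variable. -/
theorem exists_integral_exp_sq_le (s : ℝ≥0) :
    ∃ l K : ℝ, 0 < l ∧ 0 < K ∧ ∀ (Ω : Type*) [MeasurableSpace Ω] (μ : Measure Ω)
      [IsProbabilityMeasure μ] (Z : Ω → ℝ), HasSubgaussianMGF Z s μ →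
      Integrable (fun ω => Real.exp (l * Z ω ^ 2)) μ ∧ ∫ ω, Real.exp (l * Z ω ^ 2) ∂μ ≤ K := by
  -- Small enough that `s v < 1`, which makes `exp (s t² / 2)` integrable under `N(0, v)`.
  set v : ℝ≥0 := (2 * (s + 1))⁻¹ with hv
  have hv0 : 0 < v := by positivity
  have hv' : (v : ℝ) = (2 * ((s : ℝ) + 1))⁻¹ := by simp [hv]
  set γ := gaussianReal 0 v with hγ
  have hI : Integrable (fun t : ℝ => Real.exp ((s / 2 : ℝ) * t ^ 2)) γ := by
    apply integrable_exp_mul_sq_gaussianReal hv0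
    rw [hv', ← div_eq_mul_inv, div_lt_one (by positivity)]
    linarith [s.2]
  refine ⟨v / 2, ∫ t, Real.exp ((s / 2 : ℝ) * t ^ 2) ∂γ, by positivity,
    integral_exp_pos hI, fun Ω _ μ _ Z hZ => ?_⟩
  have hZm : AEMeasurable Z μ := hZ.aemeasurable
  have hmeas : AEMeasurable (fun p : Ω × ℝ => ENNReal.ofReal (Real.exp (p.2 * Z p.1)))
      (μ.prod γ) := by
    have : AEMeasurable (fun p : Ω × ℝ => Z p.1) (μ.prod γ) :=
      hZm.comp_quasiMeasurePreserving Measure.quasiMeasurePreserving_fst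
    fun_prop
  -- Gaussian linearisation: `exp (v z² / 2)` is the mean of `exp (t z)` over `t ~ N(0, v)`. After
  -- the integrals are swapped, only the moment generating function of `Z` remains.
  have hl : ∀ ω, ENNReal.ofReal (Real.exp (v / 2 * Z ω ^ 2)) =
      ∫⁻ t, ENNReal.ofReal (Real.exp (t * Z ω)) ∂γ := by
    intro ω
    rw [← ofReal_integral_eq_lintegral_ofReal]
    · have := congrFun (mgf_id_gaussianReal (μ := 0) (v := v)) (Z ω)
      rw [mgf] at this
      simp only [id, mul_comm (Z ω)] at this
      rw [this]
      congr 2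
      ring
    · simpa only [mul_comm] using integrable_exp_mul_gaussianReal (μ := 0) (v := v) (Z ω)
    · exact Filter.Eventually.of_forall fun _ => (Real.exp_pos _).le
  have key : ∫⁻ ω, ENNReal.ofReal (Real.exp (v / 2 * Z ω ^ 2)) ∂μ ≤
      ENNReal.ofReal (∫ t, Real.exp ((s / 2 : ℝ) * t ^ 2) ∂γ) := by
    simp_rw [hl]
    rw [lintegral_lintegral_swap (by exact hmeas), ofReal_integral_eq_lintegral_ofReal hI
      (Filter.Eventually.of_forall fun _ => (Real.exp_pos _).le)]
    refine lintegral_mono fun t => ?_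
    rw [← ofReal_integral_eq_lintegral_ofReal (hZ.integrable_exp_mul t)
      (Filter.Eventually.of_forall fun _ => (Real.exp_pos _).le)]
    refine ENNReal.ofReal_le_ofReal ((hZ.mgf_le t).trans_eq ?_)
    congr 1
    ring
  have hint : Integrable (fun ω => Real.exp (v / 2 * Z ω ^ 2)) μ := by
    refine ⟨by fun_prop, ?_⟩
    rw [hasFiniteIntegral_iff_ofReal (Filter.Eventually.of_forall fun _ => (Real.exp_pos _).le)]
    exact key.trans_lt ENNReal.ofReal_lt_top
  refine ⟨hint, ?_⟩
  rw [← ofReal_integral_eq_lintegral_ofReal hint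
    (Filter.Eventually.of_forall fun _ => (Real.exp_pos _).le)] at key
  exact (ENNReal.ofReal_le_ofReal_iff (integral_exp_pos hI).le).1 key

/-- The centred square of a normalised subgaussian variable has a quadratically bounded cumulant
generating function near `0`. -/
theorem exists_mgf_sq_sub_one_le (s : ℝ≥0) :
    ∃ l K : ℝ, 0 < l ∧ 0 < K ∧ ∀ (Ω : Type*) [MeasurableSpace Ω] (μ : Measure Ω)
      [IsProbabilityMeasure μ] (Z : Ω → ℝ), HasSubgaussianMGF Z s μ → ∫ ω, Z ω ^ 2 ∂μ = 1 →
      ∀ x : ℝ, |x| ≤ l → Integrable (fun ω => Real.exp (x * (Z ω ^ 2 - 1))) μ ∧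
        mgf (fun ω => Z ω ^ 2 - 1) μ x ≤ Real.exp (K * x ^ 2) := by
  obtain ⟨l, K, hl, hK, H⟩ := exists_integral_exp_sq_le s
  refine ⟨l / 2, 8 / l ^ 2 * Real.exp l * K, by positivity, by positivity,
    fun Ω _ μ _ Z hZ hZ2 x hx => ?_⟩
  obtain ⟨hi, hle⟩ := H Ω μ Z hZ
  have hZm : AEMeasurable Z μ := hZ.aemeasurable
  have hZi : Integrable (fun ω => Z ω ^ 2) μ := (hZ.memLp 2).integrable_sq
  -- The linear term has mean 0 because `Z²` has mean 1. In the remainder, both `w²` and `exp |x w|`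
  -- cost a factor `exp (l |w| / 2)`, and together these are at most `exp l * exp (l z²)`.
  have hpt : ∀ z : ℝ, Real.exp (x * (z ^ 2 - 1)) ≤ 1 + x * (z ^ 2 - 1) +
      x ^ 2 * (8 / l ^ 2 * Real.exp l) * Real.exp (l * z ^ 2) := by
    intro z
    set w := z ^ 2 - 1 with hw
    have h1 := exp_le_one_add_add_sq_mul_exp (x * w)
    have h2 : |x * w| ≤ l / 2 * |w| := by
      rw [abs_mul]
      exact mul_le_mul_of_nonneg_right hx (abs_nonneg w)
    have h3 : (l / 2 * |w|) ^ 2 / 2 ≤ Real.exp (l / 2 * |w|) := by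
      have := Real.pow_div_factorial_le_exp (l / 2 * |w|) (by positivity) 2
      simpa using this
    have h4 : w ^ 2 ≤ 8 / l ^ 2 * Real.exp (l / 2 * |w|) := by
      rw [mul_pow, sq_abs] at h3
      rw [div_mul_eq_mul_div, le_div_iff₀ (by positivity)]
      linarith
    have h5 : |w| ≤ z ^ 2 + 1 := abs_le.2 ⟨by nlinarith [sq_nonneg z], by linarith⟩
    have h6 : Real.exp (l / 2 * |w|) * Real.exp (l / 2 * |w|) ≤
        Real.exp l * Real.exp (l * z ^ 2) := by
      rw [← Real.exp_add, ← Real.exp_add]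
      apply Real.exp_le_exp.2
      nlinarith
    calc Real.exp (x * w) ≤ 1 + x * w + (x * w) ^ 2 * Real.exp |x * w| := h1
      _ ≤ 1 + x * w + x ^ 2 * (8 / l ^ 2 * Real.exp (l / 2 * |w|)) * Real.exp (l / 2 * |w|) := by
        rw [mul_pow]
        gcongr
      _ = 1 + x * w + x ^ 2 * (8 / l ^ 2) * (Real.exp (l / 2 * |w|) * Real.exp (l / 2 * |w|)) := by
        ring
      _ ≤ 1 + x * w + x ^ 2 * (8 / l ^ 2) * (Real.exp l * Real.exp (l * z ^ 2)) := by
        gcongr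
      _ = _ := by ring
  have hc : Integrable (fun ω => x * (Z ω ^ 2 - 1)) μ :=
    (hZi.sub (integrable_const _)).const_mul _
  have hlin : Integrable (fun ω => 1 + x * (Z ω ^ 2 - 1)) μ :=
    (integrable_const _).add hc
  have hrhs := hlin.add (hi.const_mul (x ^ 2 * (8 / l ^ 2 * Real.exp l)))
  have hexp : Integrable (fun ω => Real.exp (x * (Z ω ^ 2 - 1))) μ := by
    refine hrhs.mono' (by fun_prop) (Filter.Eventually.of_forall fun ω => ?_)
    rw [Real.norm_of_nonneg (Real.exp_pos _).le]
    exact hpt (Z ω)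
  refine ⟨hexp, ?_⟩
  have hI := integral_mono hexp hrhs fun ω => hpt (Z ω)
  simp only [Pi.add_apply] at hI
  rw [integral_add hlin (hi.const_mul _), integral_add (integrable_const _) hc,
    integral_const_mul, integral_const_mul,
    integral_sub hZi (integrable_const _), hZ2] at hI
  simp only [integral_const, probReal_univ, smul_eq_mul, mul_one, sub_self, mul_zero,
    add_zero] at hI
  refine hI.trans (le_trans ?_ (Real.add_one_le_exp _))
  have : x ^ 2 * (8 / l ^ 2 * Real.exp l) * ∫ ω, Real.exp (l * Z ω ^ 2) ∂μ ≤
      x ^ 2 * (8 / l ^ 2 * Real.exp l) * K := by gcongr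
  linarith

/-- Concentration of a sum of squares of independent normalised subgaussian variables. -/
theorem exists_measure_sum_sq_le (s : ℝ≥0) {t : ℝ} (ht : 0 < t) :
    ∃ c : ℝ, 0 < c ∧ ∀ (Ω : Type*) [MeasurableSpace Ω] (μ : Measure Ω)
      [IsProbabilityMeasure μ] (m : ℕ) (Z : Fin m → Ω → ℝ), (∀ i, Measurable (Z i)) →
      iIndepFun Z μ → (∀ i, HasSubgaussianMGF (Z i) s μ) → (∀ i, ∫ ω, Z i ω ^ 2 ∂μ = 1) →
      μ.real {ω | t * m < |∑ i, Z i ω ^ 2 - m|} ≤ 2 * Real.exp (-c * m) := by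
  obtain ⟨l, K, hl, hK, H⟩ := exists_mgf_sq_sub_one_le s
  -- Chernoff parameter: it gives `K x² ≤ x t / 2`, so half of the gain `x t` survives.
  set x := min l (t / (2 * K)) with hx
  have hx0 : 0 < x := by positivity
  have hxK : K * x ≤ t / 2 := by
    have : x ≤ t / (2 * K) := min_le_right _ _
    rw [le_div_iff₀ (by positivity)] at this
    linarith
  refine ⟨x * t / 2, by positivity, fun Ω _ μ _ m Z hZm hind hZ hZ2 => ?_⟩
  set W : Fin m → Ω → ℝ := fun i ω => Z i ω ^ 2 - 1 with hW
  have hWm : ∀ i, Measurable (W i) := fun i => by fun_prop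
  have hWi : iIndepFun W μ := hind.comp (fun _ z => z ^ 2 - 1) (fun _ => by fun_prop)
  have hS : ∀ ω, (∑ i, W i) ω = ∑ i, Z i ω ^ 2 - m := by
    intro ω
    simp [hW, Finset.sum_apply]
  have hbound : ∀ y : ℝ, |y| = x → Integrable (fun ω => Real.exp (y * (∑ i, W i) ω)) μ ∧
      mgf (∑ i, W i) μ y ≤ Real.exp (K * x ^ 2 * m) := by
    intro y hy
    have hy' : |y| ≤ l := hy.trans_le (min_le_left _ _)
    constructor
    · exact hWi.integrable_exp_mul_sum hWm fun i _ => (H Ω μ (Z i) (hZ i) (hZ2 i) y hy').1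
    · rw [hWi.mgf_sum hWm]
      refine (Finset.prod_le_prod (fun i _ => mgf_nonneg) fun i _ =>
        (H Ω μ (Z i) (hZ i) (hZ2 i) y hy').2).trans_eq ?_
      rw [Finset.prod_const, ← Real.exp_nat_mul, ← hy, sq_abs]
      simp
      ring
  have hfin : Real.exp (-x * (t * m)) * Real.exp (K * x ^ 2 * m) ≤
      Real.exp (-(x * t / 2) * m) := by
    rw [← Real.exp_add]
    apply Real.exp_le_exp.2
    have : 0 ≤ x * m := by positivity
    nlinarith
  have hup : μ.real {ω | t * m ≤ (∑ i, W i) ω} ≤ Real.exp (-(x * t / 2) * m) := by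
    obtain ⟨h1, h2⟩ := hbound x (abs_of_pos hx0)
    refine (measure_ge_le_exp_mul_mgf (t * m) hx0.le h1).trans (le_trans ?_ hfin)
    gcongr
  have hlow : μ.real {ω | (∑ i, W i) ω ≤ -(t * m)} ≤ Real.exp (-(x * t / 2) * m) := by
    obtain ⟨h1, h2⟩ := hbound (-x) (by rw [abs_neg, abs_of_pos hx0])
    refine (measure_le_le_exp_mul_mgf (-(t * m)) (by linarith) h1).trans (le_trans ?_ hfin)
    rw [show - -x * -(t * m) = -x * (t * m) by ring]
    gcongr
  calc μ.real {ω | t * m < |∑ i, Z i ω ^ 2 - m|}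
      ≤ μ.real ({ω | t * m ≤ (∑ i, W i) ω} ∪ {ω | (∑ i, W i) ω ≤ -(t * m)}) := by
        refine measureReal_mono fun ω hω => ?_
        simp only [Set.mem_ofPred_eq, Set.mem_union, hS] at hω ⊢
        rcases lt_abs.1 hω with h | h
        · exact Or.inl h.le
        · exact Or.inr (by linarith)
    _ ≤ _ := (measureReal_union_le _ _).trans (by linarith)

/-! ### Concentration for a fixed matrix. -/

/-- Independence of a doubly indexed family passes to its rows. -/
theorem iIndepFun_rows {Ω ι κ β : Type*} [MeasurableSpace Ω] [MeasurableSpace β] {μ : Measure Ω}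
    [IsProbabilityMeasure μ] {X : ι → κ → Ω → β} (hX : ∀ i j, Measurable (X i j))
    (h : iIndepFun (fun (p : ι × κ) ω => X p.1 p.2 ω) μ) :
    iIndepFun (fun i ω j => X i j ω) μ := by
  have : ∀ i j, IsProbabilityMeasure (μ.map (X i j)) :=
    fun i j => Measure.isProbabilityMeasure_map (hX i j).aemeasurable
  have hrow : ∀ i, μ.map (fun ω j => X i j ω) = Measure.infinitePi fun j => μ.map (X i j) :=
    fun i => (h.precomp (Prod.mk_right_injective i)).map_fun_eq_infinitePi_map (hX i)
  rw [iIndepFun_iff_map_fun_eq_infinitePi_map (by fun_prop)]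
  simp_rw [hrow]
  have hjoint := h.map_fun_eq_infinitePi_map fun p : ι × κ => hX p.1 p.2
  -- The joint law of all entries is a product measure, and currying it gives the product of the row
  -- laws.
  rw [← Measure.infinitePi_map_curry, ← hjoint, Measure.map_map (by fun_prop) (by fun_prop)]
  rfl

/-- By `1 + y ≤ exp y`, the function `exp (s t² / 2) - 1 - t e` is nonnegative. It vanishes at `t =
0`, so its derivative `-e` there is 0. -/
theorem integral_eq_zero_of_hasSubgaussianMGF {Ω : Type*} [MeasurableSpace Ω] {μ : Measure Ω}
    [IsProbabilityMeasure μ] {Z : Ω → ℝ} {s : ℝ≥0} (hZ : HasSubgaussianMGF Z s μ) :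
    ∫ ω, Z ω ∂μ = 0 := by
  set e := ∫ ω, Z ω ∂μ with he
  have hi : Integrable Z μ := hZ.integrable
  let g : ℝ → ℝ := fun t => Real.exp (s * t ^ 2 / 2) - (1 + t * e)
  have hg : ∀ t, 0 ≤ g t := by
    intro t
    have h1 : ∫ ω, (1 + t * Z ω) ∂μ ≤ mgf Z μ t :=
      integral_mono ((integrable_const _).add (hi.const_mul t)) (hZ.integrable_exp_mul t)
        fun ω => by
          have := Real.add_one_le_exp (t * Z ω)
          simp only
          linarith
    rw [integral_add (integrable_const _) (hi.const_mul t), integral_const_mul] at h1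
    simp only [integral_const, probReal_univ, smul_eq_mul, one_mul] at h1
    have := h1.trans (hZ.mgf_le t)
    simp only [g]
    linarith
  have hmin : IsLocalMin g 0 := Filter.Eventually.of_forall fun t => by
    have : g 0 = 0 := by simp [g]
    rw [this]
    exact hg t
  have hd : HasDerivAt g (Real.exp ((s : ℝ) * 0 ^ 2 / 2) * ((s : ℝ) * (2 * 0) / 2) - e) 0 := by
    have h1 : HasDerivAt (fun t : ℝ => (s : ℝ) * t ^ 2 / 2) ((s : ℝ) * (2 * 0) / 2) 0 := by
      have := ((hasDerivAt_pow 2 (0 : ℝ)).const_mul (s : ℝ)).div_const 2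
      simpa using this
    have h2 : HasDerivAt (fun t : ℝ => 1 + t * e) e 0 := by
      have := ((hasDerivAt_id (0 : ℝ)).mul_const e).const_add 1
      simpa using this
    exact h1.exp.sub h2
  have := hmin.hasDerivAt_eq_zero hd
  simp only [mul_zero, zero_div] at this
  linarith

theorem frobeniusNorm_sq {n₁ n₂ : ℕ} (X : Matrix (Fin n₁) (Fin n₂) ℝ) :
    frobeniusNorm X ^ 2 = ∑ i, ∑ j, X i j ^ 2 :=
  Real.sq_sqrt (by positivity)

theorem frobeniusNorm_eq_norm_vec {n₁ n₂ : ℕ} (X : Matrix (Fin n₁) (Fin n₂) ℝ) :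
    frobeniusNorm X = ‖(WithLp.toLp 2 X.vec : EuclideanSpace ℝ (Fin n₂ × Fin n₁))‖ := by
  rw [frobeniusNorm, EuclideanSpace.norm_eq, Fintype.sum_prod_type, Finset.sum_comm]
  simp [Matrix.vec]

/-- Concentration of the squared norm of the image of a fixed matrix. -/
theorem exists_measure_samplingMap_le (s : ℝ≥0) {t : ℝ} (ht : 0 < t) :
    ∃ c : ℝ, 0 < c ∧ ∀ (m n₁ n₂ : ℕ), 0 < m → ∀ (Ω : Type*) [MeasurableSpace Ω] (μ : Measure Ω)
      [IsProbabilityMeasure μ] (A : Ω → Matrix (Fin m) (Fin n₂ × Fin n₁) ℝ),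
      (∀ i j, Measurable fun ω => A ω i j) →
      iIndepFun (fun (p : Fin m × (Fin n₂ × Fin n₁)) ω => A ω p.1 p.2) μ →
      (∀ i j, (EntryEnsemble.subgaussian s).IsEntryLaw m (μ.map fun ω => A ω i j)) →
      ∀ X : Matrix (Fin n₁) (Fin n₂) ℝ,
        μ.real {ω | ¬ ((1 - t) * frobeniusNorm X ^ 2 ≤ ‖samplingMap (A ω) X‖ ^ 2 ∧
          ‖samplingMap (A ω) X‖ ^ 2 ≤ (1 + t) * frobeniusNorm X ^ 2)} ≤ 2 * Real.exp (-c * m) := by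
  obtain ⟨c, hc, H⟩ := exists_measure_sum_sq_le s ht
  refine ⟨c, hc, fun m n₁ n₂ hm Ω _ μ _ A hA hind hlaw X => ?_⟩
  have hm' : (0 : ℝ) < m := by exact_mod_cast hm
  set f := frobeniusNorm X with hf
  rcases (show 0 ≤ f from Real.sqrt_nonneg _).eq_or_lt with hf0 | hf0
  · have hX : WithLp.toLp 2 X.vec = (0 : EuclideanSpace ℝ (Fin n₂ × Fin n₁)) := by
      rw [← norm_eq_zero, ← frobeniusNorm_eq_norm_vec, ← hf, ← hf0]
    have hX' : X.vec = 0 := congrArg WithLp.ofLp hX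
    have : ∀ ω, samplingMap (A ω) X = 0 := fun ω => by
      simp [samplingMap, hX']
    simp only [this, ← hf0]
    simp
    positivity
  -- Scaled so that `∑ a² = m`, which cancels the `1/m` in both the variance and the subgaussian
  -- parameter.
  set a : Fin n₂ × Fin n₁ → ℝ := fun p => Real.sqrt m / f * X.vec p with ha
  have hfa : ∑ p, X.vec p ^ 2 = f ^ 2 := by
    rw [hf, frobeniusNorm_eq_norm_vec, EuclideanSpace.norm_sq_eq]
    simp
  have hasum : ∑ p, a p ^ 2 = m := by
    simp only [ha, mul_pow, ← Finset.mul_sum, hfa, div_pow, Real.sq_sqrt hm'.le]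
    field_simp
  set Z : Fin m → Ω → ℝ := fun i ω => ∑ p, a p * A ω i p with hZ
  have hsub : ∀ i p, HasSubgaussianMGF (fun ω => A ω i p) (s / m) μ := fun i p =>
    (HasSubgaussianMGF.id_map_iff (hA i p).aemeasurable).1 (hlaw i p).2.2
  have hindrow : ∀ i, iIndepFun (fun p ω => a p * A ω i p) μ := fun i =>
    (hind.precomp (Prod.mk_right_injective i)).comp (fun p x => a p * x) fun p => by fun_prop
  have hZsub : ∀ i, HasSubgaussianMGF (Z i) s μ := by
    intro i
    have h1 := HasSubgaussianMGF.sum_of_iIndepFun (hindrow i) (s := Finset.univ)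
      fun p _ => (hsub i p).const_mul (a p)
    convert h1 using 1
    have hs : (s : ℝ) = ∑ p, a p ^ 2 * ((s / m : ℝ≥0) : ℝ) := by
      rw [← Finset.sum_mul, hasum]
      push_cast
      field_simp
    apply NNReal.eq
    refine hs.trans ?_
    rw [NNReal.coe_sum]
    rfl
  have hZm : ∀ i, Measurable (Z i) := fun i => by fun_prop
  have hZ2 : ∀ i, ∫ ω, Z i ω ^ 2 ∂μ = 1 := by
    intro i
    have h1 := variance_of_integral_eq_zero (hZm i).aemeasurable
      (integral_eq_zero_of_hasSubgaussianMGF (hZsub i))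
    have h2 : variance (Z i) μ = ∑ p, variance (fun ω => a p * A ω i p) μ := by
      have := IndepFun.variance_sum (μ := μ) (X := fun p ω => a p * A ω i p) (s := Finset.univ)
        (fun p _ => ((hsub i p).const_mul (a p)).memLp 2)
        (fun p _ q _ hpq => (hindrow i).indepFun hpq)
      rw [← this]
      congr 1
      ext ω
      simp [hZ]
    have h3 : ∀ p, variance (fun ω => A ω i p) μ = 1 / m := fun p => by
      rw [← (hlaw i p).2.1, variance_id_map (hA i p).aemeasurable]
    rw [← h1, h2]
    simp only [variance_const_mul, h3, ← Finset.sum_mul, hasum]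
    field_simp
  have hZind : iIndepFun Z μ := by
    have := iIndepFun_rows (X := fun i p ω => A ω i p) hA hind
    exact this.comp (fun _ x => ∑ p, a p * x p) fun _ => by fun_prop
  have hnorm : ∀ ω, ‖samplingMap (A ω) X‖ ^ 2 * m = f ^ 2 * ∑ i, Z i ω ^ 2 := by
    intro ω
    rw [EuclideanSpace.norm_sq_eq, Finset.sum_mul, Finset.mul_sum]
    refine Finset.sum_congr rfl fun i _ => ?_
    have : Z i ω = Real.sqrt m / f * (samplingMap (A ω) X) i := by
      simp only [hZ, ha, samplingMap, LinearMap.coe_mk, AddHom.coe_mk, Matrix.mulVec, dotProduct,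
        Finset.mul_sum]
      exact Finset.sum_congr rfl fun p _ => by ring
    rw [this, mul_pow, div_pow, Real.sq_sqrt hm'.le, Real.norm_eq_abs, sq_abs]
    field_simp
  refine le_trans (measureReal_mono fun ω hω => ?_) (H Ω μ m Z hZm hZind hZsub hZ2)
  simp only [Set.mem_ofPred_eq] at hω ⊢
  by_contra! hcon
  apply hω
  have hf2 : 0 < f ^ 2 := by positivity
  obtain ⟨h1, h2⟩ := abs_le.1 hcon
  have h3 := hnorm ω
  constructor
  · refine le_of_mul_le_mul_right ?_ hm'
    rw [h3]
    nlinarith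
  · refine le_of_mul_le_mul_right ?_ hm'
    rw [h3]
    nlinarith

/-! ### Factorisation of sparse low-rank matrices. -/

theorem frobeniusNorm_nonneg {n₁ n₂ : ℕ} (X : Matrix (Fin n₁) (Fin n₂) ℝ) :
    0 ≤ frobeniusNorm X := Real.sqrt_nonneg _

theorem frobeniusNorm_smul {n₁ n₂ : ℕ} (c : ℝ) (X : Matrix (Fin n₁) (Fin n₂) ℝ) :
    frobeniusNorm (c • X) = |c| * frobeniusNorm X := by
  rw [frobeniusNorm_eq_norm_vec, frobeniusNorm_eq_norm_vec, Matrix.vec_smul, WithLp.toLp_smul,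
    norm_smul, Real.norm_eq_abs]

theorem frobeniusNorm_add_le {n₁ n₂ : ℕ} (X Y : Matrix (Fin n₁) (Fin n₂) ℝ) :
    frobeniusNorm (X + Y) ≤ frobeniusNorm X + frobeniusNorm Y := by
  simp only [frobeniusNorm_eq_norm_vec, Matrix.vec_add, WithLp.toLp_add]
  exact norm_add_le _ _

theorem eq_zero_of_frobeniusNorm_eq_zero {n₁ n₂ : ℕ} {X : Matrix (Fin n₁) (Fin n₂) ℝ}
    (h : frobeniusNorm X = 0) : X = 0 := by
  rw [frobeniusNorm_eq_norm_vec, norm_eq_zero] at h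
  ext i j
  exact congrFun (congrArg WithLp.ofLp h) (j, i)

theorem rank_smul_le {n₁ n₂ : ℕ} (c : ℝ) (X : Matrix (Fin n₁) (Fin n₂) ℝ) :
    (c • X).rank ≤ X.rank := by
  have : c • X = X * (c • (1 : Matrix (Fin n₂) (Fin n₂) ℝ)) := by simp
  rw [this]
  exact Matrix.rank_mul_le_left _ _

theorem IsJointSparse.smul {n₁ n₂ k : ℕ} {X : Matrix (Fin n₁) (Fin n₂) ℝ} (h : IsJointSparse k X)
    (c : ℝ) : IsJointSparse k (c • X) := by
  refine (Set.ncard_le_ncard ?_ (Set.toFinite _)).trans h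
  rintro i ⟨j, hj⟩
  refine ⟨j, fun h0 => hj ?_⟩
  simp [h0]

/-- The matrix with rows in `S` whose columns are the images under `U` of the vectors `B j`. -/
noncomputable def extendProduct {n₁ n₂ r : ℕ} (S : Finset (Fin n₁))
    (U : EuclideanSpace ℝ (Fin r) →L[ℝ] EuclideanSpace ℝ S)
    (B : PiLp 2 fun _ : Fin n₂ => EuclideanSpace ℝ (Fin r)) : Matrix (Fin n₁) (Fin n₂) ℝ :=
  Matrix.of fun i j => if h : i ∈ S then U (B j) ⟨i, h⟩ else 0

section ExtendProduct

variable {n₁ n₂ r : ℕ} (S : Finset (Fin n₁))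
  (U U' : EuclideanSpace ℝ (Fin r) →L[ℝ] EuclideanSpace ℝ S)
  (B B' : PiLp 2 fun _ : Fin n₂ => EuclideanSpace ℝ (Fin r))

/-- Telescoping `UB - U'B' = (U - U')B + U'(B - B')`. Each error term again has rank at most `r` and
rows in `S`, so the bounds for the class apply to it. -/
theorem extendProduct_eq_add : extendProduct S U B =
    extendProduct S U' B' + (extendProduct S (U - U') B + extendProduct S U' (B - B')) := by
  ext i j
  by_cases h : i ∈ S <;> simp [extendProduct, h]

theorem frobeniusNorm_extendProduct_le :
    frobeniusNorm (extendProduct S U B) ≤ ‖U‖ * ‖B‖ := by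
  refine le_of_abs_le (abs_le_of_sq_le_sq ?_ (by positivity))
  rw [frobeniusNorm_sq, mul_pow, PiLp.norm_sq_eq_of_L2, Finset.sum_comm, Finset.mul_sum]
  refine Finset.sum_le_sum fun j _ => ?_
  have h1 : ∑ i, extendProduct S U B i j ^ 2 = ‖U (B j)‖ ^ 2 := by
    rw [EuclideanSpace.norm_sq_eq, ← Finset.sum_subset (Finset.subset_univ S), ← Finset.sum_coe_sort]
    · refine Finset.sum_congr rfl fun i _ => ?_
      simp [extendProduct]
    · intro i _ hi
      simp [extendProduct, hi]
  rw [h1, ← mul_pow]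
  gcongr
  exact U.le_opNorm _

theorem rank_extendProduct_le : (extendProduct S U B).rank ≤ r := by
  let M : Matrix (Fin n₁) (Fin r) ℝ :=
    Matrix.of fun i a => if h : i ∈ S then U (EuclideanSpace.single a 1) ⟨i, h⟩ else 0
  let N : Matrix (Fin r) (Fin n₂) ℝ := Matrix.of fun a j => B j a
  have : extendProduct S U B = M * N := by
    ext i j
    rw [Matrix.mul_apply]
    by_cases h : i ∈ S
    · have hB : B j = ∑ a, B j a • EuclideanSpace.single a (1 : ℝ) := by
        ext b
        simp [Pi.single_apply]
      simp only [extendProduct, M, N, Matrix.of_apply, h, dite_true]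
      conv_lhs => rw [hB]
      simp [mul_comm]
    · simp [extendProduct, M, h]
  rw [this]
  exact (Matrix.rank_mul_le_left _ _).trans M.rank_le_width

theorem isJointSparse_extendProduct {k : ℕ} (hS : S.card ≤ k) :
    IsJointSparse k (extendProduct S U B) := by
  refine le_trans (Set.ncard_le_ncard (t := (S : Set (Fin n₁))) ?_ (Set.toFinite _))
    ((Set.ncard_coe_finset S).trans_le hS)
  rintro i ⟨j, hj⟩
  by_contra h
  exact hj (by simp_all [extendProduct])

end ExtendProduct

/-- A space of dimension at most `r` embeds isometrically into `ℝ^r`. -/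
theorem exists_linearIsometry_euclideanSpace {V : Type*} [NormedAddCommGroup V]
    [InnerProductSpace ℝ V] [FiniteDimensional ℝ V] {r : ℕ} (h : Module.finrank ℝ V ≤ r) :
    Nonempty (V →ₗᵢ[ℝ] EuclideanSpace ℝ (Fin r)) := by
  let b := stdOrthonormalBasis ℝ V
  let v : Fin (Module.finrank ℝ V) → EuclideanSpace ℝ (Fin r) :=
    fun a => EuclideanSpace.single (Fin.castLE h a) 1
  have hv : Orthonormal ℝ v :=
    (EuclideanSpace.orthonormal_single (𝕜 := ℝ) (ι := Fin r)).comp _ (Fin.castLE_injective h)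
  refine ⟨(b.toBasis.constr ℝ v).isometryOfOrthonormal (v := b.toBasis)
    (by simp) ?_⟩
  convert hv using 1
  ext1 a
  simp

/-- A matrix of rank at most `r` with rows in `S` factors through `ℝ^r`. -/
theorem exists_eq_extendProduct {n₁ n₂ r : ℕ} (S : Finset (Fin n₁))
    (X : Matrix (Fin n₁) (Fin n₂) ℝ) (hr : X.rank ≤ r) (hS : ∀ i ∉ S, ∀ j, X i j = 0) :
    ∃ (U : EuclideanSpace ℝ (Fin r) →L[ℝ] EuclideanSpace ℝ S)
      (B : PiLp 2 fun _ : Fin n₂ => EuclideanSpace ℝ (Fin r)),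
      ‖U‖ ≤ 1 ∧ ‖B‖ ≤ frobeniusNorm X ∧ X = extendProduct S U B := by
  let R : (Fin n₁ → ℝ) →ₗ[ℝ] EuclideanSpace ℝ S :=
    { toFun := fun x => WithLp.toLp 2 fun i => x i
      map_add' := fun _ _ => rfl
      map_smul' := fun _ _ => rfl }
  -- The column space restricted to `S`. Once `V` is embedded in `ℝ^r` by `J`, the columns of `B`
  -- are the images of those of `X`, and `U` is the adjoint of `J`, which undoes the embedding.
  let V : Submodule ℝ (EuclideanSpace ℝ S) := (Submodule.span ℝ (Set.range X.col)).map R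
  have hV : Module.finrank ℝ V ≤ r := by
    refine (Submodule.finrank_map_le _ _).trans ?_
    rwa [← Matrix.rank_eq_finrank_span_cols]
  obtain ⟨J⟩ := exists_linearIsometry_euclideanSpace hV
  have hx : ∀ j, R (X.col j) ∈ V := fun j =>
    Submodule.mem_map_of_mem (Submodule.subset_span ⟨j, rfl⟩)
  let x : Fin n₂ → V := fun j => ⟨R (X.col j), hx j⟩
  refine ⟨V.subtypeL ∘L J.toContinuousLinearMap.adjoint, WithLp.toLp 2 fun j => J (x j), ?_, ?_, ?_⟩
  · refine (ContinuousLinearMap.opNorm_comp_le _ _).trans ?_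
    rw [LinearIsometryEquiv.norm_map]
    exact mul_le_one₀ V.norm_subtypeL_le (norm_nonneg J.toContinuousLinearMap) J.norm_toContinuousLinearMap_le
  · refine le_of_abs_le (abs_le_of_sq_le_sq ?_ (frobeniusNorm_nonneg X))
    rw [frobeniusNorm_sq, PiLp.norm_sq_eq_of_L2, Finset.sum_comm]
    refine Finset.sum_le_sum fun j _ => ?_
    simp only [LinearIsometry.norm_map]
    have hcol : ‖x j‖ ^ 2 = ∑ i : S, X i j ^ 2 :=
      (EuclideanSpace.norm_sq_eq (R (X.col j))).trans
        (Finset.sum_congr rfl fun i _ => sq_abs (X i j))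
    rw [hcol, Finset.sum_coe_sort S fun i => X i j ^ 2]
    exact Finset.sum_le_sum_of_subset_of_nonneg (Finset.subset_univ S) fun _ _ _ => sq_nonneg _
  · have hJ : ∀ y : V, J.toContinuousLinearMap.adjoint (J y) = y := fun y => by
      have := J.adjoint_comp_self
      exact DFunLike.congr_fun this y
    ext i j
    by_cases h : i ∈ S
    · simp only [extendProduct, Matrix.of_apply, h, dite_true, ContinuousLinearMap.comp_apply, hJ]
      rfl
    · simp [extendProduct, h, hS i h j]

/-! ### From the net to all matrices. -/

/-- Near-isometry on a net of the factorised matrices implies the restricted isometry property. -/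
theorem hasRIP_of_net {m n₁ n₂ r k : ℕ} (hk : k ≤ n₁)
    (𝒜 : Matrix (Fin n₁) (Fin n₂) ℝ →ₗ[ℝ] EuclideanSpace ℝ (Fin m)) {δ : ℝ} (hδ0 : 0 < δ)
    (hδ1 : δ < 1)
    (h : ∀ S : Finset (Fin n₁), S.card = k →
      ∀ (U : EuclideanSpace ℝ (Fin r) →L[ℝ] EuclideanSpace ℝ S)
        (B : PiLp 2 fun _ : Fin n₂ => EuclideanSpace ℝ (Fin r)), ‖U‖ ≤ 1 → ‖B‖ ≤ 1 →
      ∃ (U' : EuclideanSpace ℝ (Fin r) →L[ℝ] EuclideanSpace ℝ S)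
        (B' : PiLp 2 fun _ : Fin n₂ => EuclideanSpace ℝ (Fin r)), ‖U'‖ ≤ 1 ∧ ‖B'‖ ≤ 1 ∧
        ‖U - U'‖ ≤ δ / 16 ∧ ‖B - B'‖ ≤ δ / 16 ∧
        (1 - δ / 8) * frobeniusNorm (extendProduct S U' B') ^ 2 ≤ ‖𝒜 (extendProduct S U' B')‖ ^ 2 ∧
        ‖𝒜 (extendProduct S U' B')‖ ^ 2 ≤ (1 + δ / 8) * frobeniusNorm (extendProduct S U' B') ^ 2) :
    HasRIP 𝒜 r k δ := by
  let T : Set (Matrix (Fin n₁) (Fin n₂) ℝ) :=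
    {X | X.rank ≤ r ∧ IsJointSparse k X ∧ frobeniusNorm X ≤ 1}
  -- Only the existence of some finite constant matters here: it makes the supremum `M` below
  -- finite.
  obtain ⟨⟨hD0, hD⟩, -⟩ := isLeast_ripConstant 𝒜 r k
  set D := ripConstant 𝒜 r k
  have hbdd : BddAbove ((fun X => ‖𝒜 X‖) '' T) := by
    refine ⟨1 + D, ?_⟩
    rintro _ ⟨X, ⟨h1, h2, h3⟩, rfl⟩
    have h4 := (hD X h1 h2).2
    have h5 : frobeniusNorm X ^ 2 ≤ 1 := pow_le_one₀ (frobeniusNorm_nonneg X) h3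
    simp only
    nlinarith [norm_nonneg (𝒜 X)]
  set M := sSup ((fun X => ‖𝒜 X‖) '' T) with hM
  have hMT : ∀ X ∈ T, ‖𝒜 X‖ ≤ M := fun X hX => le_csSup hbdd ⟨X, hX, rfl⟩
  have hscale : ∀ X : Matrix (Fin n₁) (Fin n₂) ℝ, X.rank ≤ r → IsJointSparse k X →
      ‖𝒜 X‖ ≤ M * frobeniusNorm X := by
    intro X h1 h2
    rcases (frobeniusNorm_nonneg X).eq_or_lt with h0 | h0
    · rw [← h0, eq_zero_of_frobeniusNorm_eq_zero h0.symm]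
      simp
    · have := hMT ((frobeniusNorm X)⁻¹ • X) ⟨(rank_smul_le _ _).trans h1, h2.smul _, by
        rw [frobeniusNorm_smul, abs_of_pos (by positivity), inv_mul_cancel₀ h0.ne']⟩
      rw [map_smul, norm_smul, Real.norm_of_nonneg (by positivity), inv_mul_le_iff₀ h0] at this
      linarith
  have h0T : (0 : Matrix (Fin n₁) (Fin n₂) ℝ) ∈ T :=
    ⟨by simp, by simp [IsJointSparse], by simp [frobeniusNorm]⟩
  have hM0 : 0 ≤ M := (norm_nonneg _).trans (hMT 0 h0T)
  have happrox : ∀ X ∈ T, ∃ Q : Matrix (Fin n₁) (Fin n₂) ℝ,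
      frobeniusNorm Q ≤ 1 ∧ frobeniusNorm X ≤ frobeniusNorm Q + δ / 8 ∧
      ‖𝒜 X‖ ≤ ‖𝒜 Q‖ + M * (δ / 8) ∧ ‖𝒜 Q‖ ≤ ‖𝒜 X‖ + M * (δ / 8) ∧
      (1 - δ / 8) * frobeniusNorm Q ^ 2 ≤ ‖𝒜 Q‖ ^ 2 ∧
      ‖𝒜 Q‖ ^ 2 ≤ (1 + δ / 8) * frobeniusNorm Q ^ 2 := by
    rintro X ⟨h1, h2, h3⟩
    classical
    let S₀ : Finset (Fin n₁) := Finset.univ.filter fun i => ∃ j, X i j ≠ 0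
    have hS₀ : S₀.card ≤ k := by
      rw [← Set.ncard_coe_finset]
      simpa [S₀, IsJointSparse] using h2
    -- The row support is padded to exactly `k` rows, so only sets of that size need to be counted.
    obtain ⟨S, hSS, hS⟩ := Finset.exists_superset_card_eq hS₀ (by simpa using hk)
    obtain ⟨U, B, hU, hB, rfl⟩ := exists_eq_extendProduct S X h1 fun i hi j => by
      by_contra hne
      exact hi (hSS (by simpa [S₀] using ⟨j, hne⟩))
    obtain ⟨U', B', hU', hB', hUU, hBB, hl, hu⟩ := h S hS U B hU (hB.trans h3)
    have e1 : frobeniusNorm (extendProduct S (U - U') B) ≤ δ / 16 :=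
      (frobeniusNorm_extendProduct_le _ _ _).trans
        ((mul_le_mul hUU (hB.trans h3) (norm_nonneg _) (by positivity)).trans_eq (mul_one _))
    have e2 : frobeniusNorm (extendProduct S U' (B - B')) ≤ δ / 16 :=
      (frobeniusNorm_extendProduct_le _ _ _).trans
        ((mul_le_mul hU' hBB (norm_nonneg _) zero_le_one).trans_eq (one_mul _))
    have e3 := (hscale _ (rank_extendProduct_le S (U - U') B)
      (isJointSparse_extendProduct S (U - U') B hS.le)).trans (mul_le_mul_of_nonneg_left e1 hM0)
    have e4 := (hscale _ (rank_extendProduct_le S U' (B - B'))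
      (isJointSparse_extendProduct S U' (B - B') hS.le)).trans (mul_le_mul_of_nonneg_left e2 hM0)
    have hadd := extendProduct_eq_add S U U' B B'
    set Q := extendProduct S U' B'
    set E₁ := extendProduct S (U - U') B
    set E₂ := extendProduct S U' (B - B')
    refine ⟨Q, ?_, ?_, ?_, ?_, hl, hu⟩
    · exact (frobeniusNorm_extendProduct_le _ _ _).trans (mul_le_one₀ hU' (norm_nonneg _) hB')
    · rw [hadd]
      linarith [frobeniusNorm_add_le Q (E₁ + E₂), frobeniusNorm_add_le E₁ E₂]
    · rw [hadd, map_add, map_add]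
      linarith [norm_add_le (𝒜 Q) (𝒜 E₁ + 𝒜 E₂), norm_add_le (𝒜 E₁) (𝒜 E₂)]
    · rw [hadd, map_add, map_add]
      have := norm_sub_le (𝒜 Q + (𝒜 E₁ + 𝒜 E₂)) (𝒜 E₁ + 𝒜 E₂)
      rw [add_sub_cancel_right] at this
      linarith [norm_add_le (𝒜 E₁) (𝒜 E₂)]
  -- Self-bounding: the errors are measured by `M` itself, with the small factor `δ/8`, so the
  -- inequality can be solved for `M`.
  have hMle : M ≤ (1 + δ / 16) + M * (δ / 8) := by
    refine csSup_le ⟨_, 0, h0T, rfl⟩ ?_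
    rintro _ ⟨X, hX, rfl⟩
    obtain ⟨Q, q1, -, q3, -, -, q6⟩ := happrox X hX
    have : ‖𝒜 Q‖ ≤ 1 + δ / 16 := by
      refine le_of_abs_le (abs_le_of_sq_le_sq (q6.trans ?_) (by positivity))
      have := pow_le_one₀ (n := 2) (frobeniusNorm_nonneg Q) q1
      nlinarith
    simp only
    linarith
  have hM1 : M ≤ 1 + δ / 3 := by nlinarith
  have hlow : ∀ X ∈ T, frobeniusNorm X = 1 → 1 - δ / 2 ≤ ‖𝒜 X‖ := by
    intro X hX hX1
    obtain ⟨Q, q1, q2, -, q4, q5, -⟩ := happrox X hX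
    have hq : (1 - δ / 8) * frobeniusNorm Q ≤ ‖𝒜 Q‖ := by
      refine le_of_abs_le (abs_le_of_sq_le_sq (le_trans ?_ q5) (norm_nonneg _))
      rw [mul_pow]
      gcongr
      nlinarith
    nlinarith
  intro X hr hX
  rcases (frobeniusNorm_nonneg X).eq_or_lt with h0 | h0
  · rw [← h0, eq_zero_of_frobeniusNorm_eq_zero h0.symm]
    simp
  · set f := frobeniusNorm X
    have hf1 : frobeniusNorm (f⁻¹ • X) = 1 := by
      rw [frobeniusNorm_smul, abs_of_pos (by positivity), inv_mul_cancel₀ h0.ne']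
    have h1 := hlow (f⁻¹ • X) ⟨(rank_smul_le _ _).trans hr, hX.smul _, hf1.le⟩ hf1
    rw [map_smul, norm_smul, Real.norm_of_nonneg (by positivity), inv_mul_eq_div,
      le_div_iff₀ h0] at h1
    have h2 := (hscale X hr hX).trans (mul_le_mul_of_nonneg_right hM1 h0.le)
    -- Squaring suffices since `(1 - δ/2)² ≥ 1 - δ` and `(1 + δ/3)² ≤ 1 + δ`.
    have h3 := pow_le_pow_left₀ (mul_nonneg (by linarith) h0.le) h1 2
    have h4 := pow_le_pow_left₀ (norm_nonneg _) h2 2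
    rw [mul_pow] at h3 h4
    constructor
    · refine le_trans ?_ h3
      gcongr
      nlinarith
    · refine h4.trans ?_
      gcongr
      nlinarith

/-! ### Counting and the union bound. -/

/-- The usual bound `(e n / k)^k`, from `k^k / k! ≤ e^k`. -/
theorem choose_le_exp_mul_log_add {n k : ℕ} (hk : 1 ≤ k) (hkn : k ≤ n) :
    (n.choose k : ℝ) ≤ Real.exp (k * Real.log (n / k) + k) := by
  have hk0 : (0 : ℝ) < k := by exact_mod_cast hk
  have hn0 : (0 : ℝ) < n := by exact_mod_cast hk.trans hkn
  calc (n.choose k : ℝ) ≤ (n : ℝ) ^ k / k.factorial := Nat.choose_le_pow_div k n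
    _ = ((n : ℝ) / k) ^ k * ((k : ℝ) ^ k / k.factorial) := by
      rw [div_pow]
      field_simp
    _ ≤ ((n : ℝ) / k) ^ k * Real.exp k := by
      gcongr
      exact Real.pow_div_factorial_le_exp _ hk0.le k
    _ = _ := by
      rw [Real.exp_add, Real.exp_nat_mul, Real.exp_log (by positivity)]

theorem finrank_euclideanSpace_clm {ι κ : Type*} [Fintype ι] [Fintype κ] :
    Module.finrank ℝ (EuclideanSpace ℝ ι →L[ℝ] EuclideanSpace ℝ κ) =
      Fintype.card ι * Fintype.card κ := by
  classical
  rw [← (LinearMap.toContinuousLinearMap (𝕜 := ℝ) (E := EuclideanSpace ℝ ι)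
    (F' := EuclideanSpace ℝ κ)).finrank_eq, Module.finrank_linearMap, finrank_euclideanSpace,
    finrank_euclideanSpace]

theorem finrank_piLp_euclideanSpace {ι κ : Type*} [Fintype ι] [Fintype κ] :
    Module.finrank ℝ (PiLp 2 fun _ : ι => EuclideanSpace ℝ κ) =
      Fintype.card ι * Fintype.card κ := by
  rw [(WithLp.linearEquiv 2 ℝ (ι → EuclideanSpace ℝ κ)).finrank_eq, Module.finrank_pi_fintype]
  simp

theorem corollary1 (E : EntryEnsemble) (δ : ℝ) (hδ0 : 0 < δ) (hδ1 : δ < 1) :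
    ∃ C κ₀ κ₁ : ℝ, 0 < C ∧ 0 < κ₀ ∧ 0 < κ₁ ∧
      ∀ (m n₁ n₂ k r : ℕ), 1 ≤ k → k ≤ n₁ → 1 ≤ r →
        κ₁ * (k * Real.log (n₁ / k) + (k + 1) * r + n₂ * r) ≤ (m : ℝ) →
        ∀ (Ω : Type*) [MeasurableSpace Ω] (μ : Measure Ω) [IsProbabilityMeasure μ]
          (A : Ω → Matrix (Fin m) (Fin n₂ × Fin n₁) ℝ),
          (∀ i j, Measurable fun ω => A ω i j) →
          iIndepFun (fun (p : Fin m × (Fin n₂ × Fin n₁)) ω => A ω p.1 p.2) μ →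
          (∀ i j, E.IsEntryLaw m (μ.map fun ω => A ω i j)) →
          1 - C * Real.exp (-κ₀ * m) < μ.real {ω | ripConstant (samplingMap (A ω)) r k ≤ δ} := by
  obtain ⟨s, hs⟩ := E.exists_subgaussian
  obtain ⟨c, hc, H⟩ := exists_measure_samplingMap_le s (t := δ / 8) (by positivity)
  set N : ℝ := 3 / (δ / 16) with hN
  have hN1 : 1 ≤ N := by
    rw [hN, le_div_iff₀ (by positivity)]
    linarith
  have hN0 : 0 < N := by linarith
  have hlogN : 0 ≤ Real.log N := Real.log_nonneg hN1
  -- The union bound yields the factor 2, and 3 makes the inequality strict. The third constant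
  -- gives `(1 + log N) q ≤ c m / 2`.
  refine ⟨3, c / 2, 2 * (1 + Real.log N) / c, by norm_num, by positivity, by positivity, ?_⟩
  intro m n₁ n₂ k r hk hkn hr hm Ω _ μ _ A hA hind hlaw
  set q : ℝ := k * Real.log (n₁ / k) + (k + 1) * r + n₂ * r with hq
  have hk0 : (1 : ℝ) ≤ k := by exact_mod_cast hk
  have hr0 : (1 : ℝ) ≤ r := by exact_mod_cast hr
  have hkl : 0 ≤ k * Real.log ((n₁ : ℝ) / k) := by
    refine mul_nonneg (by linarith) (Real.log_nonneg ?_)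
    rw [le_div_iff₀ (by linarith), one_mul]
    exact_mod_cast hkn
  have hn2r : (0 : ℝ) ≤ n₂ * r := by positivity
  -- The extra `k` from the binomial bound is absorbed by the term `(k + 1) r`, as `r ≥ 1`.
  have hkr : (k : ℝ) ≤ k * r := by nlinarith
  have hq0 : 0 < q := by nlinarith
  have hm0 : 0 < m := by
    have : (0 : ℝ) < m := lt_of_lt_of_le (by positivity) hm
    exact_mod_cast this
  have hqm : (1 + Real.log N) * q ≤ c / 2 * m := by
    rw [div_mul_eq_mul_div, div_le_iff₀ hc] at hm
    linarith
  have hε0 : 0 < δ / 16 := by positivity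
  have hε1 : δ / 16 ≤ 1 := by linarith
  choose NU hNU1 hNU2 hNU3 using fun S : Finset (Fin n₁) =>
    exists_net_unitBall (EuclideanSpace ℝ (Fin r) →L[ℝ] EuclideanSpace ℝ S) hε0 hε1
  obtain ⟨NB, hNB1, hNB2, hNB3⟩ :=
    exists_net_unitBall (PiLp 2 fun _ : Fin n₂ => EuclideanSpace ℝ (Fin r)) hε0 hε1
  rw [finrank_piLp_euclideanSpace, Fintype.card_fin, Fintype.card_fin] at hNB3
  let bad : Matrix (Fin n₁) (Fin n₂) ℝ → Set Ω := fun X =>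
    {ω | ¬ ((1 - δ / 8) * frobeniusNorm X ^ 2 ≤ ‖samplingMap (A ω) X‖ ^ 2 ∧
      ‖samplingMap (A ω) X‖ ^ 2 ≤ (1 + δ / 8) * frobeniusNorm X ^ 2)}
  have hbad : ∀ X, μ.real (bad X) ≤ 2 * Real.exp (-c * m) :=
    H m n₁ n₂ hm0 Ω μ A hA hind fun i j => hs m _ hm0 (hlaw i j)
  set G := {ω | ripConstant (samplingMap (A ω)) r k ≤ δ} with hG
  have hsub : Gᶜ ⊆ ⋃ S ∈ Finset.powersetCard k (Finset.univ : Finset (Fin n₁)),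
      ⋃ U ∈ NU S, ⋃ B ∈ NB, bad (extendProduct S U B) := by
    intro ω hω
    by_contra hcon
    simp only [Set.mem_iUnion, not_exists, Finset.mem_powersetCard_univ] at hcon
    apply hω
    rw [hG, Set.mem_ofPred_eq, ripConstant_le_iff _ _ _ hδ0.le]
    refine hasRIP_of_net hkn _ hδ0 hδ1 fun S hS U B hU hB => ?_
    obtain ⟨U', hU', hUU⟩ := hNU2 S U hU
    obtain ⟨B', hB', hBB⟩ := hNB2 B hB
    have hgood := hcon S hS U' hU' B' hB'
    simp only [bad, Set.mem_ofPred_eq, not_not] at hgood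
    exact ⟨U', B', hNU1 S U' hU', hNB1 B' hB', hUU, hBB, hgood⟩
  have hmeas : μ.real Gᶜ ≤ (n₁.choose k) * (N ^ (r * k) * (N ^ (n₂ * r) *
      (2 * Real.exp (-c * m)))) := by
    refine (measureReal_mono hsub (measure_ne_top _ _)).trans ?_
    refine (measureReal_biUnion_finset_le _ _).trans ?_
    refine (Finset.sum_le_card_nsmul _ _ (N ^ (r * k) * (N ^ (n₂ * r) *
      (2 * Real.exp (-c * m)))) fun S hS => ?_).trans_eq ?_
    · rw [Finset.mem_powersetCard_univ] at hS
      have hcard : ((NU S).card : ℝ) ≤ N ^ (r * k) := by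
        have := hNU3 S
        rwa [finrank_euclideanSpace_clm, Fintype.card_fin, Fintype.card_coe, hS] at this
      refine (measureReal_biUnion_finset_le _ _).trans ?_
      refine (Finset.sum_le_card_nsmul _ _ (N ^ (n₂ * r) * (2 * Real.exp (-c * m)))
        fun U _ => ?_).trans ?_
      · refine (measureReal_biUnion_finset_le _ _).trans ?_
        refine (Finset.sum_le_card_nsmul _ _ _ fun B _ => hbad _).trans ?_
        rw [nsmul_eq_mul]
        gcongr
      · rw [nsmul_eq_mul]
        gcongr
    · rw [nsmul_eq_mul, Finset.card_powersetCard, Finset.card_univ, Fintype.card_fin]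
  have hpow : ∀ a : ℕ, N ^ a = Real.exp (a * Real.log N) := fun a => by
    rw [Real.exp_nat_mul, Real.exp_log hN0]
  have hfinal : μ.real Gᶜ ≤ 2 * Real.exp (-(c / 2) * m) := by
    refine hmeas.trans ?_
    calc _ ≤ Real.exp (k * Real.log (n₁ / k) + k) * (N ^ (r * k) * (N ^ (n₂ * r) *
          (2 * Real.exp (-c * m)))) := by
          gcongr
          exact choose_le_exp_mul_log_add hk hkn
      _ = 2 * Real.exp (k * Real.log (n₁ / k) + k + (r * k) * Real.log N +
          (n₂ * r) * Real.log N + -c * m) := by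
        rw [hpow, hpow]
        simp only [Real.exp_add]
        push_cast
        ring
      _ ≤ 2 * Real.exp (-(c / 2) * m) := by
        gcongr
        have h1 : 0 ≤ Real.log N * (k * Real.log ((n₁ : ℝ) / k)) := mul_nonneg hlogN hkl
        have h2 : 0 ≤ Real.log N * r := by positivity
        rw [hq] at hqm
        nlinarith
  -- Subadditivity replaces the complement formula, so `G` need not be shown measurable.
  have h1 : (1 : ℝ) ≤ μ.real G + μ.real Gᶜ := by
    have := measureReal_union_le (μ := μ) G Gᶜ
    rwa [Set.union_compl_self, probReal_univ] at this
  have h2 := Real.exp_pos (-(c / 2) * m)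
  linarith
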